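/- The following generalized jigsaw puzzle problem is (algorithmically) undecidable. A \emph{piece} is a unit square each of whose four edges carries a color from $C=\{0,1,2,\ldots,c,\bar 1,\bar 2,\ldots,\bar c\}$. Pieces may be rotated by multiples of $90^\circ$ (but not reflected), and each piece may be used any number of times. \textbf{Input:} A positive integer $c$ and a finite set $\mathcal S$ of pieces with colors in $C$. \textbf{Question:} Is there a polyomino region $R$ (a non-empty, finite, edge-connected union of cells of the unit square grid, possibly with holes) that can be tiled by copies of pieces in $\mathcal S$, one piece per cell, so that each inner edge is shared by two adjacent pieces whose colors on that edge are $i$ and $\bar i$ for some $i>0$, and each edge on the boundary $\partial R$ has the color $0$? That is, no algorithm, given an arbitrary such $\mathcal S$, correctly decides whether such a region $R$ exists. -/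

import Mathlib

/-!
Generalized jigsaw puzzle with edge-colored unit squares.

A color is an integer: `0` is the frame color, `i > 0` is the color `i`, and `-i < 0` is the
color `i` with a bar.  Every finite set of pieces uses only finitely many colors
`0, 1, …, c, -1, …, -c`; the number `c` is not bounded in advance.
-/

namespace Jigsaw

/-- Colors `0, 1, 2, …` and their barred partners `-1, -2, …`. -/
abbrev Color : Type := ℤ

/-- A unit square piece: the colors of its top, right, bottom and left edges, in this order. -/
abbrev Piece : Type := Color × Color × Color × Color

/-- The four sides of a unit square in clockwise order:
`0` is the top, `1` the right, `2` the bottom and `3` the left side. -/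
abbrev Side : Type := Fin 4

/-- The color of a piece on a given side, before any rotation. -/
def Piece.color (p : Piece) : Side → Color := ![p.1, p.2.1, p.2.2.1, p.2.2.2]

/-- The color that a piece shows on side `d` after `r` clockwise quarter turns. -/
def Piece.rotatedColor (p : Piece) (r : Fin 4) (d : Side) : Color := p.color (d - r)

/-- A unit cell of the square lattice, given by its column and its row (rows count upwards). -/
abbrev Cell : Type := ℤ × ℤ

/-- The vector from a cell to its neighbor across side `d`. -/
def step : Side → Cell := ![(0, 1), (1, 0), (0, -1), (-1, 0)]

/-- Two cells are adjacent when they share an edge. -/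
def cellGraph : SimpleGraph Cell where
  Adj x y := |x.1 - y.1| + |x.2 - y.2| = 1
  symm := ⟨fun x y h => by rwa [abs_sub_comm y.1 x.1, abs_sub_comm y.2 x.2]⟩
  loopless := ⟨fun x h => by simp at h⟩

/-- A polyomino region: finitely many, at least one, unit cells joined edge to edge.
(The notion `SimpleGraph.Connected` includes non-emptiness.) -/
def IsPolyomino (R : Finset Cell) : Prop :=
  (cellGraph.induce (R : Set Cell)).Connected

/-- The two colors that meet at an inner edge must be `i` and `i` with a bar, where `i > 0`. -/
def Matches (a b : Color) : Prop :=
  ∃ i : ℤ, 0 < i ∧ ((a = i ∧ b = -i) ∨ (a = -i ∧ b = i))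

/-- `IsTiling S R piece rot`: placing on every cell `x` of `R` the piece `piece x`, rotated by
`rot x` clockwise quarter turns, tiles `R` by copies of pieces in `S` so that the colors match
at every inner edge and the color is `0` at every edge of the boundary of `R`. -/
structure IsTiling (S : List Piece) (R : Finset Cell)
    (piece : Cell → Piece) (rot : Cell → Fin 4) : Prop where
  mem : ∀ x ∈ R, piece x ∈ S
  inner : ∀ x ∈ R, ∀ d : Side, x + step d ∈ R →
    Matches ((piece x).rotatedColor (rot x) d)
      ((piece (x + step d)).rotatedColor (rot (x + step d)) (d + 2))
  boundary : ∀ x ∈ R, ∀ d : Side, x + step d ∉ R → (piece x).rotatedColor (rot x) d = 0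

/-- The question of the jigsaw puzzle problem: can some polyomino region be tiled by copies of
the pieces in the finite set of entries of `S`? -/
def Solvable (S : List Piece) : Prop :=
  ∃ R : Finset Cell, IsPolyomino R ∧
    ∃ (piece : Cell → Piece) (rot : Cell → Fin 4), IsTiling S R piece rot

end Jigsaw

/-!
The halting problem of a fixed Turing machine is reduced to the jigsaw puzzle.

*The machine.* A universal partial recursive function is run by one finite Post–Turing machine
(`Turing.exists_machine_of_partrec`), and its input can be chosen as a marker followed by `n` equal
symbols, so its halting problem, as a problem about `n`, is undecidable
(`Turing.exists_machine_not_computablePred`).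

*Pieces without rotations.* Label the sides of a square tile, with one set of labels for horizontal
sides and another for vertical sides, give tops and right sides the unbarred colors and bottoms and
left sides the barred ones. Then a color determines its side, adjacent pieces are rotated in the
same way, and by connectedness the whole region is a tiling with translated tiles, up to a rotation
of the plane (`Jigsaw.exists_isLabeledTiling`).

*Rows as configurations.* The tiles of the initial row have the boundary below them; the labels
of their vertical sides form a chain, so that the tops spell the initial configuration on some
finite segment of the tape, between two edge markers. All other tiles have labels below them. A row
of such tiles copies the tape, carries out one step of the machine, passing the head to a neighboring cell
through a vertical side, or, if the machine halts, closes all columns with the boundary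
(`Jigsaw.next_or_halt_of_isRow`). The left and right boundaries of the initial row are inherited by
all rows above it. Hence, if the machine does not halt, the lowest row of a tiled region forces a
row above it, and so on without end, which is impossible in a finite region
(`Jigsaw.not_solvable_of_invariant`). If the machine halts, its computation on a long enough segment
of the tape is a tiled rectangle (`Jigsaw.exists_isTower`, `Jigsaw.solvable_of_isTower`).

*Computability.* Only the tiles of the initial row depend on `n`, through a number of labels that
form a chain, so the list of pieces is a primitive recursive function of `n`, although the other
tiles are given by a noncomputable enumeration of a fixed finite set.
-/

/-! ### A fixed machine with an undecidable halting problem -/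

open Turing in
/-- Restricting a Post–Turing machine to a set of states that supports it does not change
whether it halts. -/
theorem Turing.TM0.exists_restrict_eval_dom {Γ Λ : Type} [Inhabited Γ] [Inhabited Λ]
    (M : TM0.Machine Γ Λ) (S : Finset Λ) (hS : TM0.Supports M ↑S) :
    ∃ (_ : Inhabited S) (M' : TM0.Machine Γ S),
      ∀ l, (TM0.eval M' l).Dom ↔ (TM0.eval M l).Dom := by
  classical
  let i : Inhabited S := ⟨⟨default, hS.1⟩⟩
  let f : PointedMap Γ Γ := ⟨id, rfl⟩
  let g₁ : PointedMap Λ S := ⟨fun q => if h : q ∈ S then ⟨q, h⟩ else default, by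
    rw [dif_pos (Finset.mem_coe.1 hS.1)]; rfl⟩
  have hg : ∀ q ∈ (S : Set Λ), (g₁ q : Λ) = q := by
    intro q hq
    change ((if h : q ∈ S then (⟨q, h⟩ : S) else default : S) : Λ) = q
    rw [dif_pos (Finset.mem_coe.1 hq)]
  refine ⟨i, M.map f f g₁ Subtype.val, fun l => ?_⟩
  have h := StateTransition.tr_eval_dom
    (TM0.Machine.map_respects M f f g₁ Subtype.val hS (fun _ => rfl) hg)
    (a₁ := TM0.init l) (a₂ := TM0.init l) ⟨hS.1, by
      rw [TM0.map_init]; congr 1; exact List.map_id l⟩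
  exact h

open Turing PartrecToTM2 in
theorem Turing.PartrecToTM2.trNat_two_pow_sub_one (n : ℕ) :
    trNat (2 ^ n - 1) = List.replicate n Γ'.bit1 := by
  have key : ∀ m : ℕ, trNat (2 * m + 1) = Γ'.bit1 :: trNat m := by
    intro m
    have : ((2 * m + 1 : ℕ) : Num) = Num.bit1 (m : Num) := by
      rw [← Num.bit1_of_bit1]
      push_cast
      ring
    rw [trNat, this, trNat]
    cases (m : Num) <;> rfl
  induction n with
  | zero => simp
  | succ n ih =>
    have : 2 ^ (n + 1) - 1 = 2 * (2 ^ n - 1) + 1 := by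
      have := Nat.one_le_two_pow (n := n)
      rw [pow_succ]; omega
    rw [this, key, ih, List.replicate_succ]

open Turing PartrecToTM2 in
instance Turing.PartrecToTM2.finite_K' : Finite K' := by
  refine Finite.of_injective (β := Fin 4)
    (fun k => match k with | .main => 0 | .rev => 1 | .aux => 2 | .stack => 3) ?_
  rintro (_ | _ | _ | _) (_ | _ | _ | _) h <;> first | rfl | simp at h

open Turing PartrecToTM2 in
/-- Every partial recursive function is run by one finite Post–Turing machine; the input
`2 ^ n - 1`, whose binary digits are all `1`, becomes a marker followed by `n` equal symbols. -/
theorem Turing.exists_machine_of_partrec {f : ℕ →. ℕ} (hf : Partrec f) :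
    ∃ (Γ Q : Type) (_ : Finite Γ) (_ : Finite Q) (_ : Inhabited Γ) (_ : Inhabited Q)
      (M : TM0.Machine Γ Q) (a b : Γ),
      ∀ n, (TM0.eval M (a :: List.replicate n b)).Dom ↔ (f (2 ^ n - 1)).Dom := by
  classical
  obtain ⟨c, hc⟩ := ToPartrec.Code.exists_code (Nat.Partrec'.part_iff₁.2 hf)
  let _ : Inhabited Λ' := ⟨trNormal c Cont'.halt⟩
  have h2 : ∀ m, (TM2.eval tr K'.main (trList [m])).Dom ↔ (f m).Dom := by
    intro m
    have h := tr_eval c [m]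
    have h' := hc ⟨[m], rfl⟩
    change c.eval [m] = pure <$> f m at h'
    rw [h'] at h
    have hi : (TM2.init K'.main (trList [m]) : TM2.Cfg (fun _ : K' => Γ') Λ' (Option Γ')) =
        init c [m] := by
      unfold TM2.init init
      congr 1
      funext k
      cases k <;> rfl
    unfold TM2.eval
    rw [hi]
    change (StateTransition.eval (TM2.step tr) (init c [m])).Dom ↔ _
    rw [h]
    rfl
  have hs := TM1to0.tr_supports (TM2to1.tr tr) (TM2to1.tr_supports tr (tr_supports c Cont'.halt))
  obtain ⟨_, M', hM'⟩ := TM0.exists_restrict_eval_dom _ _ hs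
  have : Finite (TM2to1.Γ' K' (fun _ => Γ')) :=
    inferInstanceAs (Finite (Bool × (K' → Option Γ')))
  refine ⟨_, _, inferInstance, inferInstance, inferInstance, inferInstance, M',
    (true, Function.update (fun _ => none) K'.main (some Γ'.cons)),
    (false, Function.update (fun _ => none) K'.main (some Γ'.bit1)), fun n => ?_⟩
  refine (hM' _).trans ?_
  rw [TM1to0.tr_eval]
  have : TM2to1.trInit K'.main (trList [2 ^ n - 1]) =
      (true, Function.update (fun _ => none) K'.main (some Γ'.cons)) ::
        List.replicate n ((false, Function.update (fun _ => none) K'.main (some Γ'.bit1)) :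
          TM2to1.Γ' K' (fun _ => Γ')) := by
    have hrev : (trList [2 ^ n - 1]).reverse = Γ'.cons :: List.replicate n Γ'.bit1 := by
      simp [trNat_two_pow_sub_one]
    unfold TM2to1.trInit
    rw [hrev]
    exact congrArg (List.cons _) List.map_replicate
  have h3 := TM2to1.tr_eval_dom tr K'.main (trList [2 ^ n - 1])
  rw [this] at h3
  exact h3.trans (h2 _)

open Turing in
/-- Some fixed finite Post–Turing machine has an undecidable halting problem, already on inputs
that are given in unary. -/
theorem Turing.exists_machine_not_computablePred :
    ∃ (Γ Q : Type) (_ : Finite Γ) (_ : Finite Q) (_ : Inhabited Γ) (_ : Inhabited Q)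
      (M : TM0.Machine Γ Q) (a b : Γ),
      ¬ ComputablePred fun n => (TM0.eval M (a :: List.replicate n b)).Dom := by
  -- `f m` runs the program with number `k` on input `0`, where `k` is determined by `2 ^ k - 1 = m`
  let g : ℕ →. ℕ := fun k => (Denumerable.ofNat Nat.Partrec.Code k).eval 0
  have hg : Partrec g :=
    Nat.Partrec.Code.eval_part.comp (Computable.ofNat Nat.Partrec.Code) (Computable.const 0)
  have hpow : Primrec fun k : ℕ => 2 ^ k - 1 := by
    have : Primrec fun k : ℕ => 2 ^ k := by
      refine (Primrec.nat_rec₁ 1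
        (Primrec.nat_mul.comp₂ (Primrec₂.const 2) Primrec₂.right)).of_eq ?_
      intro k
      induction k with
      | zero => rfl
      | succ k ih => simp only [ih, pow_succ]; ring
    exact Primrec.nat_sub.comp this (Primrec.const 1)
  let r : ℕ →. ℕ := fun m => Nat.rfind fun k => Part.some (decide (2 ^ k - 1 = m))
  have hr : Partrec r := by
    refine Partrec.rfind ?_
    have : Primrec₂ fun m k : ℕ => decide (2 ^ k - 1 = m) :=
      (Primrec.eq.comp (hpow.comp Primrec.snd) Primrec.fst).decide
    exact this.to_comp.partrec₂
  let f : ℕ →. ℕ := fun m => (r m).bind g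
  have hf : Partrec f := hr.bind (hg.comp Computable.snd)
  have hfg : ∀ n, (f (2 ^ n - 1)).Dom ↔ (g n).Dom := by
    intro n
    have : r (2 ^ n - 1) = Part.some n := by
      refine Part.eq_some_iff.2 (Nat.mem_rfind.2 ⟨by simp, fun {m} hm => ?_⟩)
      have h1 : 2 ^ m < 2 ^ n := Nat.pow_lt_pow_right (by norm_num) hm
      have h2 : 1 ≤ 2 ^ m := Nat.one_le_two_pow
      have : 2 ^ m - 1 ≠ 2 ^ n - 1 := by omega
      simpa using this
    change ((r (2 ^ n - 1)).bind g).Dom ↔ _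
    rw [this, Part.bind_some]
  obtain ⟨Γ, Q, h1, h2, h3, h4, M, a, b, h⟩ := exists_machine_of_partrec hf
  refine ⟨Γ, Q, h1, h2, h3, h4, M, a, b, fun hC => ?_⟩
  refine ComputablePred.halting_problem 0 ?_
  refine ComputablePred.computable_of_manyOneReducible (q := fun n : ℕ =>
    (TM0.eval M (a :: List.replicate n b)).Dom) ⟨Encodable.encode, Computable.encode, ?_⟩ hC
  intro c
  refine Iff.trans ?_ ((h _).trans (hfg _)).symm
  simp [g]

/-! ### Jigsaw pieces that enforce tilings without rotations -/

namespace Jigsaw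

/-- A unit square with an optional label on each side, to be placed without rotation. Horizontal
sides carry labels from `V`, vertical sides carry labels from `H`, and `none` marks a side that
lies on the boundary of the region. -/
@[ext]
structure Tile (V H : Type*) where
  top : Option V
  right : Option H
  bottom : Option V
  left : Option H

namespace Tile

variable {V H : Type*}

instance : Inhabited (Tile V H) := ⟨⟨none, none, none, none⟩⟩

/-- The label of a tile on a given side. -/
def label (t : Tile V H) : Side → Option (V ⊕ H) :=
  ![t.top.map .inl, t.right.map .inr, t.bottom.map .inl, t.left.map .inr]

/-- The non-negative color assigned to an optional label, `none` being the frame color. -/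
def labelColor {L : Type*} (e : L → ℕ) : Option L → ℤ
  | none => 0
  | some x => e x + 1

/-- Tops and right sides get unbarred colors, bottoms and left sides get barred ones. -/
def sign : Side → ℤ := ![1, 1, -1, -1]

/-- The jigsaw piece that stands for a tile, for a numbering `e` of the labels. -/
def toPiece (e : V ⊕ H → ℕ) (t : Tile V H) : Piece :=
  (labelColor e (t.top.map .inl), labelColor e (t.right.map .inr),
    -labelColor e (t.bottom.map .inl), -labelColor e (t.left.map .inr))

theorem color_toPiece (e : V ⊕ H → ℕ) (t : Tile V H) (d : Side) :
    (t.toPiece e).color d = sign d * labelColor e (t.label d) := by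
  fin_cases d <;> simp [Piece.color, toPiece, sign, label]

theorem labelColor_eq_zero {L : Type*} {e : L → ℕ} {o : Option L} :
    labelColor e o = 0 ↔ o = none := by
  cases o with
  | none => simp [labelColor]
  | some x => simp only [labelColor, reduceCtorEq, iff_false]; omega

theorem labelColor_nonneg {L : Type*} (e : L → ℕ) (o : Option L) : 0 ≤ labelColor e o := by
  cases o with
  | none => exact le_rfl
  | some x => simp only [labelColor]; omega

theorem labelColor_injective {L : Type*} {e : L → ℕ} (he : e.Injective) :
    (labelColor e).Injective := by
  rintro (_ | x) (_ | y) h <;> simp only [labelColor] at h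
  · rfl
  · omega
  · omega
  · rw [he (by omega : e x = e y)]

theorem color_toPiece_eq_zero {e : V ⊕ H → ℕ} {t : Tile V H} {d : Side} :
    (t.toPiece e).color d = 0 ↔ t.label d = none := by
  rw [color_toPiece, mul_eq_zero, labelColor_eq_zero]
  refine or_iff_right ?_
  fin_cases d <;> simp [sign]

/-- The color of a nonempty label determines the side it is on, so two sides match only if they
carry the same label and are opposite to each other. -/
theorem matches_toPiece {e : V ⊕ H → ℕ} (he : e.Injective) {t t' : Tile V H} {d d' : Side} :
    Matches ((t.toPiece e).color d) ((t'.toPiece e).color d') ↔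
      d' = d + 2 ∧ t.label d = t'.label d' ∧ t.label d ≠ none := by
  have hm : ∀ a b : ℤ, Matches a b ↔ a = -b ∧ a ≠ 0 := by
    intro a b
    constructor
    · rintro ⟨i, hi, ⟨rfl, rfl⟩ | ⟨rfl, rfl⟩⟩ <;> constructor <;> omega
    · rintro ⟨rfl, h0⟩
      rcases lt_or_gt_of_ne h0 with h0 | h0
      · exact ⟨b, by omega, Or.inr ⟨rfl, rfl⟩⟩
      · exact ⟨-b, h0, Or.inl ⟨rfl, (neg_neg b).symm⟩⟩
  rw [hm, Ne, Ne, color_toPiece_eq_zero, color_toPiece, color_toPiece]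
  have h1 := labelColor_nonneg e (t.label d)
  have h2 := labelColor_nonneg e (t'.label d')
  have h3 : labelColor e (t.label d) = 0 ↔ _ := labelColor_eq_zero
  have hinj := (labelColor_injective he).eq_iff (a := t.label d) (b := t'.label d')
  rw [← hinj, ← h3]
  -- a label from `V` sits on a top or a bottom and a label from `H` on a left or right side, so the
  -- side is known once the sign is
  have hs : labelColor e (t.label d) = labelColor e (t'.label d') →
      labelColor e (t.label d) ≠ 0 → (d' = d + 2 ↔ sign d' = - sign d) := by
    intro h h0
    rw [hinj] at h
    rw [Ne, labelColor_eq_zero] at h0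
    revert h h0
    fin_cases d <;> fin_cases d' <;> simp [label, sign] <;>
      (try cases t.top) <;> (try cases t.right) <;> (try cases t.bottom) <;>
      (try cases t.left) <;> (try cases t'.top) <;> (try cases t'.right) <;>
      (try cases t'.bottom) <;> (try cases t'.left) <;> simp
  have hd : sign d = 1 ∨ sign d = -1 := by fin_cases d <;> simp [sign]
  have hd' : sign d' = 1 ∨ sign d' = -1 := by fin_cases d' <;> simp [sign]
  constructor
  · rintro ⟨h, h0⟩
    have heq : labelColor e (t.label d) = labelColor e (t'.label d') := by
      rcases hd with hd | hd <;> rcases hd' with hd' | hd' <;> rw [hd, hd'] at h <;> omega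
    refine ⟨(hs heq h0).2 ?_, heq, h0⟩
    rcases hd with hd | hd <;> rcases hd' with hd' | hd' <;> rw [hd, hd'] at h ⊢ <;> omega
  · rintro ⟨h, heq, h0⟩
    rw [(hs heq h0).1 h, heq]
    exact ⟨by ring, heq ▸ h0⟩

end Tile

variable {V H : Type*}

/-- The set `P` of cells `(x, y)` is tiled without rotations by the tiles `f x y` from `T`: equal
labels meet on inner edges, and exactly the edges on the boundary have no label. -/
structure IsLabeledTiling (T : Set (Tile V H)) (P : ℤ → ℤ → Prop) (f : ℤ → ℤ → Tile V H) :
    Prop where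
  mem : ∀ {x y}, P x y → f x y ∈ T
  up : ∀ {x y}, P x y → P x (y + 1) → (f x y).top = (f x (y + 1)).bottom ∧ (f x y).top ≠ none
  right : ∀ {x y}, P x y → P (x + 1) y → (f x y).right = (f (x + 1) y).left ∧ (f x y).right ≠ none
  top_none : ∀ {x y}, P x y → ¬ P x (y + 1) → (f x y).top = none
  right_none : ∀ {x y}, P x y → ¬ P (x + 1) y → (f x y).right = none
  bottom_none : ∀ {x y}, P x y → ¬ P x (y - 1) → (f x y).bottom = none
  left_none : ∀ {x y}, P x y → ¬ P (x - 1) y → (f x y).left = none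

theorem exists_step_of_adj {x y : Cell} (h : cellGraph.Adj x y) : ∃ d, y = x + step d := by
  obtain ⟨a, b⟩ := x
  obtain ⟨c, d⟩ := y
  change |a - c| + |b - d| = 1 at h
  have h1 := abs_nonneg (a - c)
  have h2 := abs_nonneg (b - d)
  have h3 : (a - c = 0 ∧ (b - d = 1 ∨ b - d = -1)) ∨ (b - d = 0 ∧ (a - c = 1 ∨ a - c = -1)) := by
    rcases (by omega : |a - c| = 0 ∨ |b - d| = 0) with h | h
    · exact Or.inl ⟨abs_eq_zero.1 h, (abs_eq zero_le_one).1 (by omega)⟩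
    · exact Or.inr ⟨abs_eq_zero.1 h, (abs_eq zero_le_one).1 (by omega)⟩
  rcases h3 with ⟨h, h' | h'⟩ | ⟨h, h' | h'⟩
  · exact ⟨2, by ext <;> simp [step] <;> omega⟩
  · exact ⟨0, by ext <;> simp [step] <;> omega⟩
  · exact ⟨3, by ext <;> simp [step] <;> omega⟩
  · exact ⟨1, by ext <;> simp [step] <;> omega⟩

theorem IsTiling.exists_rot_eq {e : V ⊕ H → ℕ} (he : e.Injective) {L : List (Tile V H)}
    {R : Finset Cell} (hR : IsPolyomino R) {piece : Cell → Piece} {rot : Cell → Fin 4}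
    (h : IsTiling (L.map (Tile.toPiece e)) R piece rot) : ∃ r, ∀ x ∈ R, rot x = r := by
  obtain ⟨⟨x₀, h₀⟩⟩ := hR.nonempty
  refine ⟨rot x₀, fun x hx => ?_⟩
  obtain ⟨w⟩ := hR.preconnected ⟨x, hx⟩ ⟨x₀, h₀⟩
  have key : ∀ u v : (R : Set Cell), (cellGraph.induce (R : Set Cell)).Walk u v →
      rot u = rot v := by
    intro u v w
    induction w with
    | nil => rfl
    | @cons u v _ hadj _ ih =>
      rw [← ih]
      obtain ⟨d, hd⟩ := exists_step_of_adj (SimpleGraph.comap_adj.1 hadj)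
      have hu : (u : Cell) ∈ R := u.2
      have hv : (v : Cell) ∈ R := v.2
      change (v : Cell) = (u : Cell) + step d at hd
      obtain ⟨t, -, ht⟩ := List.mem_map.1 (h.mem _ hu)
      obtain ⟨t', -, ht'⟩ := List.mem_map.1 (h.mem _ hv)
      have := h.inner u hu d (hd ▸ hv)
      rw [← hd, ← ht, ← ht'] at this
      have := ((Tile.matches_toPiece he).1 this).1
      have h4 : ∀ a b c : Fin 4, c + 2 - b = c - a + 2 → a = b := by decide
      exact h4 _ _ _ this
  exact key _ _ w

/-- A solution of the puzzle is, up to a rotation of the plane, a tiling without rotations. -/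
theorem exists_isLabeledTiling {e : V ⊕ H → ℕ} (he : e.Injective) {L : List (Tile V H)}
    (h : Solvable (L.map (Tile.toPiece e))) :
    ∃ P f, IsLabeledTiling {t | t ∈ L} P f ∧ {p : ℤ × ℤ | P p.1 p.2}.Finite ∧ ∃ x y, P x y := by
  obtain ⟨R, hR, piece, rot, h⟩ := h
  obtain ⟨r, hr⟩ := h.exists_rot_eq he hR
  obtain ⟨⟨x₀, h₀⟩⟩ := hR.nonempty
  choose! g hgL hg using fun x hx => List.mem_map.1 (h.mem x hx)
  -- the cell reached from `x₀` by going `x` steps to the right and `y` steps upwards, as seen by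
  -- an observer who is turned like the pieces
  let ρ : ℤ → ℤ → Cell := fun x y => x₀ + x • step (1 + r) + y • step (0 + r)
  have inner : ∀ z ∈ R, ∀ d, z + step (d + r) ∈ R →
      (g z).label d = (g (z + step (d + r))).label (d + 2) ∧ (g z).label d ≠ none := by
    intro z hz d hd
    have := h.inner z hz (d + r) hd
    rw [hr _ hz, hr _ hd, ← hg _ hz, ← hg _ hd] at this
    unfold Piece.rotatedColor at this
    rw [add_sub_cancel_right, show d + r + 2 - r = d + 2 by abel] at this
    exact ((Tile.matches_toPiece he).1 this).2
  have outer : ∀ z ∈ R, ∀ d, z + step (d + r) ∉ R → (g z).label d = none := by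
    intro z hz d hd
    have := h.boundary z hz (d + r) hd
    rw [hr _ hz, ← hg _ hz] at this
    unfold Piece.rotatedColor at this
    rwa [add_sub_cancel_right, Tile.color_toPiece_eq_zero] at this
  have hneg : ∀ d : Side, step (d + 2) = - step d := by decide
  have e0 : ∀ x y, ρ x (y + 1) = ρ x y + step (0 + r) := fun x y => by
    simp only [ρ]; rw [add_smul, one_smul]; abel
  have e1 : ∀ x y, ρ (x + 1) y = ρ x y + step (1 + r) := fun x y => by
    simp only [ρ]; rw [add_smul, one_smul]; abel
  have e2 : ∀ x y, ρ x (y - 1) = ρ x y + step (2 + r) := fun x y => by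
    simp only [ρ]
    rw [show 2 + r = 0 + r + 2 by abel, hneg, sub_smul, one_smul]; abel
  have e3 : ∀ x y, ρ (x - 1) y = ρ x y + step (3 + r) := fun x y => by
    simp only [ρ]
    rw [show 3 + r = 1 + r + 2 by rw [show (3 : Fin 4) = 1 + 2 by decide]; abel, hneg, sub_smul,
      one_smul]; abel
  have hinj : Function.Injective fun p : ℤ × ℤ => ρ p.1 p.2 := by
    rintro ⟨a, b⟩ ⟨c, d⟩ hab
    simp only [ρ, Prod.ext_iff, Prod.fst_add, Prod.snd_add, Prod.smul_fst, Prod.smul_snd] at hab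
    clear * - hab
    obtain ⟨h1, h2⟩ := hab
    fin_cases r <;> simp [step] at h1 h2 ⊢ <;> omega
  refine ⟨fun x y => ρ x y ∈ R, fun x y => g (ρ x y), ⟨fun h => hgL _ h, ?_, ?_, ?_, ?_, ?_, ?_⟩,
    ?_, 0, 0, ?_⟩
  · intro x y hz hz'
    rw [e0] at hz' ⊢
    have := inner _ hz _ hz'
    simpa [Tile.label, Option.map_injective Sum.inl_injective |>.eq_iff] using this
  · intro x y hz hz'
    rw [e1] at hz' ⊢
    have := inner _ hz _ hz'
    simpa [Tile.label, Option.map_injective Sum.inr_injective |>.eq_iff] using this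
  · intro x y hz hz'
    rw [e0] at hz'
    simpa [Tile.label] using outer _ hz _ hz'
  · intro x y hz hz'
    rw [e1] at hz'
    simpa [Tile.label] using outer _ hz _ hz'
  · intro x y hz hz'
    rw [e2] at hz'
    simpa [Tile.label] using outer _ hz _ hz'
  · intro x y hz hz'
    rw [e3] at hz'
    simpa [Tile.label] using outer _ hz _ hz'
  · exact (R.finite_toSet.preimage hinj.injOn).subset fun p hp => hp
  · simpa [ρ] using h₀

theorem isPolyomino_rectangle {m n : ℕ} (hm : 0 < m) (hn : 0 < n) :
    IsPolyomino (Finset.Ico (0 : ℤ) m ×ˢ Finset.Ico (0 : ℤ) n) := by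
  have hmem : ∀ i j : ℕ, i < m → j < n → ((i : ℤ), (j : ℤ)) ∈
      ((Finset.Ico (0 : ℤ) m ×ˢ Finset.Ico (0 : ℤ) n : Finset Cell) : Set Cell) := by
    intro i j hi hj
    simp only [Finset.coe_product, Finset.coe_Ico, Set.mem_prod, Set.mem_Ico]
    omega
  have key : ∀ (i j : ℕ) (hi : i < m) (hj : j < n), (cellGraph.induce _).Reachable
      ⟨_, hmem 0 0 hm hn⟩ ⟨_, hmem i j hi hj⟩ := by
    intro i
    induction i with
    | zero =>
      intro j hi
      induction j with
      | zero => intro; exact SimpleGraph.Reachable.refl _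
      | succ j ih =>
        intro hj
        refine (ih (by omega)).trans (SimpleGraph.Adj.reachable ?_)
        simp [cellGraph]
    | succ i ih =>
      intro j hi hj
      refine (ih j (by omega) hj).trans (SimpleGraph.Adj.reachable ?_)
      simp [cellGraph]
  refine (SimpleGraph.connected_iff_exists_forall_reachable _).2 ⟨⟨_, hmem 0 0 hm hn⟩, ?_⟩
  rintro ⟨⟨x, y⟩, h⟩
  have h' := h
  simp only [Finset.coe_product, Finset.coe_Ico, Set.mem_prod, Set.mem_Ico] at h'
  obtain ⟨⟨h1, h2⟩, h3, h4⟩ := h'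
  lift x to ℕ using h1
  lift y to ℕ using h3
  exact key x y (by omega) (by omega)

theorem solvable_of_rectangle {e : V ⊕ H → ℕ} (he : e.Injective) {L : List (Tile V H)} {m n : ℕ}
    (hm : 0 < m) (hn : 0 < n) {f : ℤ → ℤ → Tile V H}
    (h : IsLabeledTiling {t | t ∈ L} (fun x y => (0 ≤ x ∧ x < m) ∧ 0 ≤ y ∧ y < n) f) :
    Solvable (L.map (Tile.toPiece e)) := by
  refine ⟨_, isPolyomino_rectangle hm hn, fun z => (f z.1 z.2).toPiece e, fun _ => 0, ?_⟩
  constructor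
  · intro z hz
    simp only [Finset.mem_product, Finset.mem_Ico] at hz
    exact List.mem_map_of_mem (h.mem hz)
  · rintro ⟨x, y⟩ hz d hd
    unfold Piece.rotatedColor
    rw [sub_zero, sub_zero, Tile.matches_toPiece he]
    refine ⟨rfl, ?_⟩
    simp only [Finset.mem_product, Finset.mem_Ico] at hz hd
    fin_cases d
    · have := h.up hz (by simpa [step] using hd)
      simpa [step, Tile.label, Option.map_injective Sum.inl_injective |>.eq_iff] using this
    · have := h.right hz (by simpa [step] using hd)
      simpa [step, Tile.label, Option.map_injective Sum.inr_injective |>.eq_iff] using this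
    · have := h.up (x := x) (y := y - 1) (by simpa [step, ← sub_eq_add_neg] using hd)
        (by simpa using hz)
      rw [sub_add_cancel] at this
      have h' := this.1 ▸ this.2
      simpa [step, Tile.label, Option.map_injective Sum.inl_injective |>.eq_iff,
        ← sub_eq_add_neg] using And.intro this.1.symm h'
    · have := h.right (x := x - 1) (y := y) (by simpa [step, ← sub_eq_add_neg] using hd)
        (by simpa using hz)
      rw [sub_add_cancel] at this
      have h' := this.1 ▸ this.2
      simpa [step, Tile.label, Option.map_injective Sum.inr_injective |>.eq_iff,
        ← sub_eq_add_neg] using And.intro this.1.symm h'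
  · rintro ⟨x, y⟩ hz d hd
    unfold Piece.rotatedColor
    rw [sub_zero, Tile.color_toPiece_eq_zero]
    simp only [Finset.mem_product, Finset.mem_Ico] at hz hd
    fin_cases d
    · have := h.top_none hz (by simpa [step] using hd)
      simpa [step, Tile.label] using this
    · have := h.right_none hz (by simpa [step] using hd)
      simpa [step, Tile.label] using this
    · have := h.bottom_none hz (by simpa [step, ← sub_eq_add_neg] using hd)
      simpa [step, Tile.label] using this
    · have := h.left_none hz (by simpa [step, ← sub_eq_add_neg] using hd)
      simpa [step, Tile.label] using this

end Jigsaw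

/-! ### Rows and towers of tiles -/

namespace Jigsaw

variable {V H : Type*}

/-- A list of tiles from `T` that fit together side by side, starting at the left label `l` and
ending at the right boundary. Inside the row there is no boundary. -/
def IsRow (T : Set (Tile V H)) : Option H → List (Tile V H) → Prop
  | l, [] => l = none
  | l, t :: ts => t ∈ T ∧ t.left = l ∧ (ts ≠ [] → t.right ≠ none) ∧ IsRow T t.right ts

/-- The row of `k` tiles of `f` that starts at the cell `(x, y)` and runs to the right. -/
def segment (f : ℤ → ℤ → Tile V H) : ℤ → ℤ → ℕ → List (Tile V H)
  | _, _, 0 => []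
  | x, y, k + 1 => f x y :: segment f (x + 1) y k

theorem map_segment_congr {α : Type*} {f : ℤ → ℤ → Tile V H} {g h : Tile V H → α} {y y' : ℤ} :
    ∀ {k : ℕ} {x : ℤ}, (∀ x', x ≤ x' → x' < x + k → g (f x' y) = h (f x' y')) →
      (segment f x y k).map g = (segment f x y' k).map h
  | 0, _, _ => rfl
  | k + 1, x, hx => by
    simp only [segment, List.map_cons]
    rw [hx x le_rfl (by push_cast; omega),
      map_segment_congr fun x' h1 h2 => hx x' (by omega) (by push_cast; omega)]

theorem forall_mem_segment {f : ℤ → ℤ → Tile V H} {p : Tile V H → Prop} {y : ℤ} :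
    ∀ {k : ℕ} {x : ℤ}, (∀ t ∈ segment f x y k, p t) ↔ ∀ x', x ≤ x' → x' < x + k → p (f x' y)
  | 0, x => by
    simp only [segment, List.not_mem_nil, false_imp_iff, implies_true, true_iff]
    intro x' h1 h2
    push_cast at h2
    omega
  | k + 1, x => by
    simp only [segment, List.forall_mem_cons]
    rw [forall_mem_segment (k := k)]
    push_cast
    constructor
    · rintro ⟨h0, h⟩ x' h1 h2
      rcases h1.eq_or_lt with rfl | h1
      · exact h0
      · exact h x' (by omega) (by omega)
    · exact fun h => ⟨h x le_rfl (by omega), fun x' h1 h2 => h x' (by omega) (by omega)⟩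

theorem IsLabeledTiling.isRow_segment {T : Set (Tile V H)} {P f} (h : IsLabeledTiling T P f)
    {y : ℤ} : ∀ {k : ℕ} {x : ℤ}, 0 < k → (∀ x', x ≤ x' → x' < x + k → P x' y) → ¬ P (x + k) y →
      IsRow T (f x y).left (segment f x y k)
  | 1, x, _, hP, hP' => ⟨h.mem (hP _ le_rfl (by simp)), rfl, fun hn => absurd rfl hn,
      h.right_none (hP _ le_rfl (by simp)) (by simpa using hP')⟩
  | k + 2, x, _, hP, hP' => by
    have h0 := h.right (hP x le_rfl (by push_cast; omega))
      (hP (x + 1) (by omega) (by push_cast; omega))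
    refine ⟨h.mem (hP _ le_rfl (by push_cast; omega)), rfl, fun _ => h0.2, ?_⟩
    rw [h0.1]
    refine h.isRow_segment k.succ_pos (fun x' h1 h2 => hP _ (by omega) ?_) ?_
    · push_cast at h2 ⊢; omega
    · convert hP' using 2; push_cast; ring

/-- An invariant of the words read off the tops of consecutive rows, which holds for the bottom row
and excludes a boundary on top of a row, makes the puzzle unsolvable: a region on which it holds
grows upwards forever. The condition `hseed` says that the vertical sides know whether they belong
to a bottom row; it prevents the rows from growing sideways. -/
theorem not_solvable_of_invariant {e : V ⊕ H → ℕ} (he : e.Injective) {L : List (Tile V H)}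
    (IsSeed : H → Prop)
    (hseed : ∀ t ∈ L, ∀ h, t.left = some h ∨ t.right = some h → (t.bottom = none ↔ IsSeed h))
    (Inv : List (Option V) → Prop)
    (h_bot : ∀ ts, ts ≠ [] → IsRow {t | t ∈ L} none ts → (∀ t ∈ ts, t.bottom = none) →
      Inv (ts.map Tile.top))
    (h_step : ∀ ts, IsRow {t | t ∈ L} none ts → Inv (ts.map Tile.bottom) → Inv (ts.map Tile.top))
    (h_top : ∀ w, Inv w → none ∉ w) : ¬ Solvable (L.map (Tile.toPiece e)) := by
  intro hS
  obtain ⟨P, f, h, hfin, x₁, y₁, h₁⟩ := exists_isLabeledTiling he hS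
  -- the leftmost cell `(a, b)` of the lowest row
  obtain ⟨⟨x₂, b⟩, h₂, hb⟩ := hfin.exists_minimalFor Prod.snd _ ⟨(x₁, y₁), h₁⟩
  obtain ⟨⟨a, b'⟩, ⟨h₃, rfl⟩, ha⟩ := (hfin.inter_of_left {p | p.2 = b}).exists_minimalFor Prod.fst _
    ⟨(x₂, b), h₂, rfl⟩
  simp only [Set.mem_ofPred_eq] at h₂ h₃
  have hlow : ∀ x, ¬ P x (b' - 1) := by
    intro x hx
    have : b' ≤ b' - 1 := hb (j := (x, b' - 1)) hx (by simp)
    omega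
  have hleft : ¬ P (a - 1) b' := by
    intro hx
    have : a ≤ a - 1 := ha (j := (a - 1, b')) ⟨hx, rfl⟩ (by simp)
    omega
  have hnot : ∃ k : ℕ, ¬ P (a + k) b' := by
    by_contra! hall
    refine Set.infinite_of_injective_forall_mem (f := fun k : ℕ => (a + (k : ℤ), b')) ?_ hall hfin
    intro i j hij
    simpa using hij
  classical
  -- the row consists of the `k` cells from `a` up to the first gap
  obtain ⟨k, hk, hkmin⟩ : ∃ k : ℕ, ¬ P (a + k) b' ∧ ∀ x, a ≤ x → x < a + k → P x b' := by
    refine ⟨Nat.find hnot, Nat.find_spec hnot, fun x h1 h2 => ?_⟩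
    obtain ⟨i, rfl⟩ := Int.le.dest h1
    exact not_not.1 (Nat.find_min hnot (by omega : i < Nat.find hnot))
  have hk0 : 0 < k := by
    rcases Nat.eq_zero_or_pos k with rfl | hk0
    · exact absurd (by simpa using h₃) hk
    · exact hk0
  have hgrow : ∀ n : ℕ, (∀ x, a ≤ x → x < a + k → P x (b' + n)) ∧ ¬ P (a - 1) (b' + n) ∧
      ¬ P (a + k) (b' + n) ∧ Inv ((segment f a (b' + n) k).map Tile.top) := by
    intro n
    induction n with
    | zero =>
      simp only [Nat.cast_zero, add_zero]
      refine ⟨hkmin, hleft, hk, h_bot _ ?_ ?_ ?_⟩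
      · obtain ⟨k, rfl⟩ := Nat.exists_eq_succ_of_ne_zero hk0.ne'
        simp [segment]
      · rw [← h.left_none h₃ hleft]
        exact h.isRow_segment hk0 hkmin hk
      · rw [forall_mem_segment]
        exact fun x h1 h2 => h.bottom_none (hkmin x h1 h2) (hlow x)
    | succ n ih =>
      push_cast
      rw [← add_assoc]
      generalize b' + (n : ℤ) = y at ih
      obtain ⟨hP, hl, hr, hI⟩ := ih
      have hne : ∀ x, a ≤ x → x < a + k → (f x y).top ≠ none := by
        rw [← forall_mem_segment (p := fun t => t.top ≠ none)]
        intro t ht h0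
        exact h_top _ hI (List.mem_map.2 ⟨t, ht, h0⟩)
      have hP' : ∀ x, a ≤ x → x < a + k → P x (y + 1) := fun x h1 h2 =>
        not_not.1 fun hn => hne x h1 h2 (h.top_none (hP x h1 h2) hn)
      have hup : ∀ x, a ≤ x → x < a + k → (f x (y + 1)).bottom ≠ none := fun x h1 h2 =>
        (h.up (hP x h1 h2) (hP' x h1 h2)).1 ▸ hne x h1 h2
      -- neighbors in a row are both in the initial row or both above it
      have hside : ∀ x, P x (y + 1) → P (x + 1) (y + 1) →
          ((f x (y + 1)).bottom = none ↔ (f (x + 1) (y + 1)).bottom = none) := by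
        intro x hx hx'
        obtain ⟨h1, h2⟩ := h.right hx hx'
        obtain ⟨c, hc⟩ := Option.ne_none_iff_exists'.1 h2
        rw [hseed _ (h.mem hx) c (Or.inr hc), hseed _ (h.mem hx') c (Or.inl (h1 ▸ hc))]
      have hl' : ¬ P (a - 1) (y + 1) := by
        intro hx
        have ha' := hP' a le_rfl (by omega)
        have := hside (a - 1) hx (by rwa [sub_add_cancel])
        rw [sub_add_cancel] at this
        exact hup a le_rfl (by omega) (this.1 (h.bottom_none hx (by rwa [add_sub_cancel_right])))
      have hr' : ¬ P (a + k) (y + 1) := by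
        intro hx
        have ha' := hP' (a + k - 1) (by omega) (by omega)
        have := hside (a + k - 1) ha' (by rwa [sub_add_cancel])
        rw [sub_add_cancel] at this
        exact hup _ (by omega) (by omega)
          (this.2 (h.bottom_none hx (by rwa [add_sub_cancel_right])))
      refine ⟨hP', hl', hr', h_step _ ?_ ?_⟩
      · rw [← h.left_none (hP' a le_rfl (by omega)) hl']
        exact h.isRow_segment hk0 hP' hr'
      · rwa [← map_segment_congr fun x h1 h2 => (h.up (hP x h1 h2) (hP' x h1 h2)).1]
  refine Set.infinite_of_injective_forall_mem (f := fun n : ℕ => (a, b' + (n : ℤ))) ?_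
    (fun n => (hgrow n).1 a le_rfl (by omega)) hfin
  intro i j hij
  simpa using hij

/-- A list of rows of tiles, from bottom to top, that fit on top of each other, from the word
`w` at the bottom up to the boundary. -/
def IsTower (T : Set (Tile V H)) : List (Option V) → List (List (Tile V H)) → Prop
  | w, [] => ∀ o ∈ w, o = none
  | w, r :: rs => IsRow T none r ∧ r.map Tile.bottom = w ∧ (rs ≠ [] → none ∉ r.map Tile.top) ∧
      IsTower T (r.map Tile.top) rs

theorem IsRow.getElem {T : Set (Tile V H)} : ∀ {ts : List (Tile V H)} {l : Option H},
    IsRow T l ts → ∀ (i : ℕ) (hi : i < ts.length), ts[i] ∈ T ∧ (i = 0 → ts[i].left = l) ∧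
      (∀ h : i + 1 < ts.length, ts[i].right = ts[i + 1].left ∧ ts[i].right ≠ none) ∧
      (i + 1 = ts.length → ts[i].right = none)
  | [], _, _, _, hi => absurd hi (by simp)
  | [t], l, ⟨h1, h2, h3, h4⟩, i, hi => by
    obtain rfl : i = 0 := by simpa using hi
    exact ⟨h1, fun _ => h2, fun h => absurd h (by simp), fun _ => h4⟩
  | t :: t' :: ts, l, ⟨h1, h2, h3, h4⟩, 0, hi =>
    ⟨h1, fun _ => h2, fun h => ⟨h4.2.1.symm, h3 (by simp)⟩, fun h => by simp at h⟩
  | t :: t' :: ts, l, ⟨h1, h2, h3, h4⟩, i + 1, hi => by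
    obtain ⟨g1, g2, g3, g4⟩ := h4.getElem i (by simpa using hi)
    exact ⟨g1, fun h => by simp at h, fun h => g3 (by simpa using h),
      fun h => g4 (by simpa using h)⟩

theorem IsTower.getElem {T : Set (Tile V H)} : ∀ {rs : List (List (Tile V H))}
    {w : List (Option V)}, IsTower T w rs → ∀ (j : ℕ) (hj : j < rs.length),
      IsRow T none rs[j] ∧ rs[j].length = w.length ∧ (j = 0 → rs[j].map Tile.bottom = w) ∧
      (∀ h : j + 1 < rs.length, rs[j].map Tile.top = rs[j + 1].map Tile.bottom ∧
        none ∉ rs[j].map Tile.top) ∧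
      (j + 1 = rs.length → ∀ t ∈ rs[j], t.top = none)
  | [], _, _, _, hj => absurd hj (by simp)
  | [r], w, ⟨h1, h2, h3, h4⟩, j, hj => by
    obtain rfl : j = 0 := by simpa using hj
    exact ⟨h1, by simp [← h2], fun _ => h2, fun h => absurd h (by simp),
      fun _ t ht => h4 _ (List.mem_map_of_mem ht)⟩
  | r :: r' :: rs, w, ⟨h1, h2, h3, h4⟩, 0, hj =>
    ⟨h1, by simp [← h2], fun _ => h2, fun h => ⟨h4.2.1.symm, h3 (by simp)⟩, fun h => by simp at h⟩
  | r :: r' :: rs, w, ⟨h1, h2, h3, h4⟩, j + 1, hj => by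
    obtain ⟨g1, g2, g3, g4, g5⟩ := h4.getElem j (by simpa using hj)
    exact ⟨g1, by simpa [← h2] using g2, fun h => by simp at h,
      fun h => g4 (by simpa using h), fun h => g5 (by simpa using h)⟩

/-- A tower of rows that starts at the boundary fills a rectangle. -/
theorem solvable_of_isTower {e : V ⊕ H → ℕ} (he : e.Injective) {L : List (Tile V H)} {m : ℕ}
    (hm : 0 < m) {rs : List (List (Tile V H))} (hrs : rs ≠ [])
    (h : IsTower {t | t ∈ L} (List.replicate m none) rs) : Solvable (L.map (Tile.toPiece e)) := by
  have hrow := fun j hj => (h.getElem j hj)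
  simp only [List.length_replicate] at hrow
  let f : ℤ → ℤ → Tile V H := fun x y => (rs.getD y.toNat []).getD x.toNat default
  have hf : ∀ i j : ℕ, ∀ (hj : j < rs.length) (hi : i < rs[j].length), f i j = rs[j][i] := by
    intro i j hj hi
    simp [f, hj, hi]
  have hlab : ∀ {α : Type _} (g g' : Tile V H → α) {i j j' : ℕ} (hj : j < rs.length)
      (hj' : j' < rs.length), i < m → rs[j].map g = rs[j'].map g' → g (f i j) = g' (f i j') := by
    intro α g g' i j j' hj hj' hi heq
    rw [hf i j hj ((hrow j hj).2.1.symm ▸ hi), hf i j' hj' ((hrow j' hj').2.1.symm ▸ hi)]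
    have := congrArg (fun l => l[i]?) heq
    simpa [(hrow j hj).2.1, (hrow j' hj').2.1, hi] using this
  refine solvable_of_rectangle he hm (List.length_pos_of_ne_nil hrs) (f := f) ?_
  constructor
  · rintro x y ⟨⟨hx0, hx⟩, hy0, hy⟩
    lift x to ℕ using hx0
    lift y to ℕ using hy0
    have hy' : y < rs.length := by exact_mod_cast hy
    have hx' : x < rs[y].length := by rw [(hrow y hy').2.1]; exact_mod_cast hx
    rw [hf x y hy' hx']
    exact ((hrow y hy').1.getElem x hx').1
  · rintro x y ⟨⟨hx0, hx⟩, hy0, hy⟩ ⟨-, -, hy1⟩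
    lift x to ℕ using hx0
    lift y to ℕ using hy0
    have hy' : y < rs.length := by omega
    have hy1' : y + 1 < rs.length := by omega
    have hx' : x < rs[y].length := by rw [(hrow y hy').2.1]; omega
    obtain ⟨g1, g2⟩ := (hrow y hy').2.2.2.1 hy1'
    refine ⟨by exact_mod_cast hlab Tile.top Tile.bottom hy' hy1' (by omega) g1, ?_⟩
    rw [hf x y hy' hx']
    exact fun h0 => g2 (List.mem_map.2 ⟨_, List.getElem_mem hx', h0⟩)
  · rintro x y ⟨⟨hx0, hx⟩, hy0, hy⟩ ⟨⟨-, hx1⟩, -⟩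
    lift x to ℕ using hx0
    lift y to ℕ using hy0
    have hy' : y < rs.length := by omega
    have hx1' : x + 1 < rs[y].length := by rw [(hrow y hy').2.1]; omega
    have := ((hrow y hy').1.getElem x (by omega)).2.2.1 hx1'
    have e1 := hf (x + 1) y hy' hx1'
    push_cast at e1
    rw [hf x y hy' (by omega), e1]
    exact this
  · rintro x y ⟨⟨hx0, hx⟩, hy0, hy⟩ hn
    lift x to ℕ using hx0
    lift y to ℕ using hy0
    have hy' : y < rs.length := by omega
    have hx' : x < rs[y].length := by rw [(hrow y hy').2.1]; omega
    rw [hf x y hy' hx']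
    exact (hrow y hy').2.2.2.2 (by omega) _ (List.getElem_mem hx')
  · rintro x y ⟨⟨hx0, hx⟩, hy0, hy⟩ hn
    lift x to ℕ using hx0
    lift y to ℕ using hy0
    have hy' : y < rs.length := by omega
    have hl := (hrow y hy').2.1
    have hx' : x < rs[y].length := by omega
    rw [hf x y hy' hx']
    exact ((hrow y hy').1.getElem x hx').2.2.2 (by omega)
  · rintro x y ⟨⟨hx0, hx⟩, hy0, hy⟩ hn
    lift x to ℕ using hx0
    lift y to ℕ using hy0
    have hy' : y < rs.length := by omega
    have hl := (hrow y hy').2.1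
    have hx' : x < rs[y].length := by omega
    rw [hf x y hy' hx']
    have hb := (hrow y hy').2.2.1 (by omega)
    exact List.eq_of_mem_replicate (hb ▸ List.mem_map_of_mem (List.getElem_mem hx'))
  · rintro x y ⟨⟨hx0, hx⟩, hy0, hy⟩ hn
    lift x to ℕ using hx0
    lift y to ℕ using hy0
    have hy' : y < rs.length := by omega
    have hl := (hrow y hy').2.1
    have hx' : x < rs[y].length := by omega
    rw [hf x y hy' hx']
    exact ((hrow y hy').1.getElem x hx').2.1 (by omega)

end Jigsaw

/-! ### Tiles that simulate a Turing machine -/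

namespace Jigsaw

open Turing

/-- Labels of the horizontal tile sides, which pass information upwards: the two ends of a tape
segment, a tape symbol, or a tape symbol scanned by the head in a given state. -/
inductive Vert (Γ Q : Type)
  | edge : Vert Γ Q
  | sym : Γ → Vert Γ Q
  | head : Q → Γ → Vert Γ Q

/-- Labels of the vertical tile sides, which pass information along a row: no signal, the signal that
the machine has halted, the head moving right or left and entering a given state, and the sides
within the initial row. -/
inductive Horiz (Q : Type)
  | idle : Horiz Q
  | halt : Horiz Q
  | toRight : Q → Horiz Q
  | toLeft : Q → Horiz Q
  | seed : ℕ → Horiz Q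

section

variable {Γ Q : Type}

open Vert Horiz

/-- The word for a tape segment that ends on the right with the symbols `v`. -/
def rightWord (v : List Γ) : List (Option (Vert Γ Q)) :=
  v.map (fun c => some (sym c)) ++ [some edge]

/-- The word for a tape segment `u a v`, without its left end, with the head in state `q`
scanning `a`. -/
def bodyWord (u : List Γ) (q : Q) (a : Γ) (v : List Γ) : List (Option (Vert Γ Q)) :=
  u.map (fun c => some (sym c)) ++ some (head q a) :: rightWord v

/-- The word for a tape segment `u a v` with the head in state `q` scanning `a`. -/
def word (u : List Γ) (q : Q) (a : Γ) (v : List Γ) : List (Option (Vert Γ Q)) :=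
  some edge :: bodyWord u q a v

theorem none_notMem_word (u : List Γ) (q : Q) (a : Γ) (v : List Γ) : none ∉ word u q a v := by
  simp [word, bodyWord, rightWord]

variable [Inhabited Q]

/-- The tiles of the rows above the initial one. The bottom of such a row carries a configuration of
the machine `M`, its top the next configuration, or the boundary if the machine has halted. -/
inductive IsStepTile (M : TM0.Machine Γ Q) : Tile (Vert Γ Q) (Horiz Q) → Prop
  | leftEdge : IsStepTile M ⟨some edge, some idle, some edge, none⟩
  | leftEdgeHalt : IsStepTile M ⟨none, some halt, some edge, none⟩
  | rightEdge : IsStepTile M ⟨some edge, none, some edge, some idle⟩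
  | rightEdgeHalt : IsStepTile M ⟨none, none, some edge, some halt⟩
  | copy (c : Γ) : IsStepTile M ⟨some (sym c), some idle, some (sym c), some idle⟩
  | erase (c : Γ) : IsStepTile M ⟨none, some halt, some (sym c), some halt⟩
  | write {q a q' b} : M q a = some (q', .write b) →
      IsStepTile M ⟨some (head q' b), some idle, some (head q a), some idle⟩
  | moveRight {q a q'} : M q a = some (q', .move .right) →
      IsStepTile M ⟨some (sym a), some (toRight q'), some (head q a), some idle⟩
  | moveLeft {q a q'} : M q a = some (q', .move .left) →
      IsStepTile M ⟨some (sym a), some idle, some (head q a), some (toLeft q')⟩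
  | fromLeft (q : Q) (c : Γ) :
      IsStepTile M ⟨some (head q c), some idle, some (sym c), some (toRight q)⟩
  | fromRight (q : Q) (c : Γ) :
      IsStepTile M ⟨some (head q c), some (toLeft q), some (sym c), some idle⟩
  | close {q a} : M q a = none → IsStepTile M ⟨none, some halt, some (head q a), some halt⟩

/-- The tile of the initial row for the `i`-th symbol `b` after the marker. -/
def inputTile (b : Γ) (i : ℕ) : Tile (Vert Γ Q) (Horiz Q) :=
  ⟨some (sym b), some (seed (i + 2)), none, some (seed (i + 1))⟩

/-- The tiles of the initial row, whose top is the initial configuration on the input that consists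
of `a` and `n` symbols `b`, padded with blanks on both sides. -/
inductive IsSeedTile [Inhabited Γ] (a b : Γ) (n : ℕ) : Tile (Vert Γ Q) (Horiz Q) → Prop
  | leftEdge : IsSeedTile a b n ⟨some edge, some (seed 0), none, none⟩
  | leftBlank : IsSeedTile a b n ⟨some (sym default), some (seed 0), none, some (seed 0)⟩
  | start : IsSeedTile a b n ⟨some (head default a), some (seed 1), none, some (seed 0)⟩
  | input (i : ℕ) : i < n → IsSeedTile a b n (inputTile b i)
  | rightBlank :
      IsSeedTile a b n ⟨some (sym default), some (seed (n + 1)), none, some (seed (n + 1))⟩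
  | rightEdge : IsSeedTile a b n ⟨some edge, none, none, some (seed (n + 1))⟩

/-- The configuration with state `q`, scanned symbol `a` and the symbols `u` and `v` to the left and
right, surrounded by blanks. -/
def cfg [Inhabited Γ] (u : List Γ) (q : Q) (a : Γ) (v : List Γ) : TM0.Cfg Γ Q :=
  ⟨q, Tape.mk' (ListBlank.mk u.reverse) (ListBlank.mk (a :: v))⟩

/-- One step of the machine on a tape segment that the head does not leave. -/
inductive Next (M : TM0.Machine Γ Q) :
    List Γ → Q → Γ → List Γ → List Γ → Q → Γ → List Γ → Prop
  | write {u q a v q' b} : M q a = some (q', .write b) → Next M u q a v u q' b v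
  | right {u q a c v q'} : M q a = some (q', .move .right) →
      Next M u q a (c :: v) (u ++ [a]) q' c v
  | left {u q a c v q'} : M q a = some (q', .move .left) →
      Next M (u ++ [c]) q a v u q' c (a :: v)

theorem Next.cons {M : TM0.Machine Γ Q} {u q a v u' q' a' v'} (x : Γ)
    (h : Next M u q a v u' q' a' v') : Next M (x :: u) q a v (x :: u') q' a' v' := by
  cases h with
  | write h => exact .write h
  | right h => exact .right h
  | left h => rw [← List.cons_append]; exact .left h

theorem Next.step_eq [Inhabited Γ] {M : TM0.Machine Γ Q} {u q a v u' q' a' v'}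
    (h : Next M u q a v u' q' a' v') : TM0.step M (cfg u q a v) = some (cfg u' q' a' v') := by
  cases h with
  | write h => simp [TM0.step, cfg, h, ← ListBlank.cons_mk]
  | right h =>
    simp [TM0.step, cfg, h, Tape.move_right_mk', ← ListBlank.cons_mk]
  | left h =>
    simp [TM0.step, cfg, h, Tape.move_left_mk', ← ListBlank.cons_mk]

theorem exists_next [Inhabited Γ] {M : TM0.Machine Γ Q} {u q a v c} (hu : u ≠ []) (hv : v ≠ [])
    (h : TM0.step M (cfg u q a v) = some c) :
    ∃ u' q' a' v', Next M u q a v u' q' a' v' ∧ c = cfg u' q' a' v' ∧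
      u.length ≤ u'.length + 1 ∧ v.length ≤ v'.length + 1 := by
  have key : ∀ {u' q' a' v'}, Next M u q a v u' q' a' v' → c = cfg u' q' a' v' := fun hn =>
    Option.some_injective _ (h.symm.trans hn.step_eq)
  cases hM : M q a with
  | none =>
    simp [TM0.step, cfg, hM] at h
  | some p =>
    obtain ⟨q', (_ | _) | b⟩ := p
    · obtain ⟨u, x, rfl⟩ := List.eq_nil_or_concat u |>.resolve_left hu
      rw [List.concat_eq_append] at *
      exact ⟨u, q', x, a :: v, .left hM, key (.left hM), by simp, by simp; omega⟩
    · obtain ⟨x, v, rfl⟩ := List.exists_cons_of_ne_nil hv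
      exact ⟨u ++ [a], q', x, v, .right hM, key (.right hM), by simp; omega, by simp⟩
    · exact ⟨u, q', b, v, .write hM, key (.write hM), by simp, by simp⟩

/-- To the right of the head no tile can emit the head to the left. -/
theorem not_isRow_toLeft {M : TM0.Machine Γ Q} {ts : List (Tile (Vert Γ Q) (Horiz Q))} {q : Q}
    {v : List Γ} (hb : ts.map Tile.bottom = rightWord v) :
    ¬ IsRow {t | IsStepTile M t} (some (toLeft q)) ts := by
  intro h
  cases ts with
  | nil => cases v <;> simp [rightWord] at hb
  | cons t ts =>
    obtain ⟨ht, hl, -, -⟩ := h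
    cases v <;> cases ht <;> simp [rightWord] at hb hl

theorem map_top_of_isRow_idle {M : TM0.Machine Γ Q} : ∀ {ts : List (Tile (Vert Γ Q) (Horiz Q))}
    {v : List Γ}, ts.map Tile.bottom = rightWord v → IsRow {t | IsStepTile M t} (some idle) ts →
      ts.map Tile.top = rightWord v
  | [], v, hb, _ => by cases v <;> simp [rightWord] at hb
  | t :: ts, [], hb, ⟨ht, hl, hne, hr⟩ => by
    cases ht <;> simp [rightWord] at hb hl ⊢
    exact hb
  | t :: ts, c :: v, hb, ⟨ht, hl, hne, hr⟩ => by
    have hb' : ts.map Tile.bottom = rightWord v := by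
      simpa [rightWord] using (List.cons_eq_cons.1 hb).2
    cases ht <;> simp [rightWord] at hb hl
    · have := map_top_of_isRow_idle hb' hr
      simpa [rightWord, hb.1] using this
    · exact absurd hr (not_isRow_toLeft hb')

theorem map_top_of_isRow_toRight {M : TM0.Machine Γ Q} {ts : List (Tile (Vert Γ Q) (Horiz Q))}
    {v : List Γ} {q : Q} (hb : ts.map Tile.bottom = rightWord v)
    (h : IsRow {t | IsStepTile M t} (some (toRight q)) ts) :
    ∃ c v', v = c :: v' ∧ ts.map Tile.top = some (head q c) :: rightWord v' := by
  cases ts with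
  | nil => cases v <;> simp [rightWord] at hb
  | cons t ts =>
    obtain ⟨ht, hl, -, hr⟩ := h
    cases v with
    | nil => cases ht <;> simp [rightWord] at hb hl
    | cons c v =>
      have hb' : ts.map Tile.bottom = rightWord v := by
        simpa [rightWord] using (List.cons_eq_cons.1 hb).2
      refine ⟨c, v, rfl, ?_⟩
      cases ht <;> simp [rightWord] at hb hl
      have := map_top_of_isRow_idle hb' hr
      simp [this, hl, hb.1]

theorem exists_next_of_isRow {M : TM0.Machine Γ Q} {q : Q} {a : Γ} {v : List Γ} :
    ∀ {u : List Γ} {ts : List (Tile (Vert Γ Q) (Horiz Q))}, ts.map Tile.bottom = bodyWord u q a v →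
      IsRow {t | IsStepTile M t} (some idle) ts →
      ∃ u' q' a' v', Next M u q a v u' q' a' v' ∧ ts.map Tile.top = bodyWord u' q' a' v'
  | u, [], hb, _ => by cases u <;> simp [bodyWord] at hb
  | [], t :: ts, hb, ⟨ht, hl, hne, hr⟩ => by
    have hb' : ts.map Tile.bottom = rightWord v := (List.cons_eq_cons.1 hb).2
    cases ht <;> simp [bodyWord] at hb hl
    case write q₁ a₁ q' b hM =>
      obtain ⟨⟨rfl, rfl⟩, -⟩ := hb
      refine ⟨_, _, _, _, .write hM, ?_⟩
      simp [bodyWord, map_top_of_isRow_idle hb' hr]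
    case moveRight q₁ a₁ q' hM =>
      obtain ⟨⟨rfl, rfl⟩, -⟩ := hb
      obtain ⟨c, v', rfl, ht⟩ := map_top_of_isRow_toRight hb' hr
      refine ⟨_, _, _, _, .right hM, ?_⟩
      simp [bodyWord, ht]
  | x :: u, t :: ts, hb, ⟨ht, hl, hne, hr⟩ => by
    have hb' : ts.map Tile.bottom = bodyWord u q a v := (List.cons_eq_cons.1 hb).2
    cases ht <;> simp [bodyWord] at hb hl
    case copy c =>
      obtain ⟨u', q', a', v', hn, ht⟩ := exists_next_of_isRow hb' hr
      exact ⟨_, _, _, _, hn.cons x, by simp [bodyWord, ht, hb.1]⟩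
    case fromRight q' c =>
      obtain ⟨rfl, -⟩ := hb
      -- the head has to come from the next cell
      cases ts with
      | nil => cases u <;> simp [bodyWord] at hb'
      | cons t ts =>
        obtain ⟨ht, hl, -, hr⟩ := hr
        cases u with
        | cons y u => cases ht <;> simp [bodyWord] at hb' hl
        | nil =>
          have hb'' : ts.map Tile.bottom = rightWord v := (List.cons_eq_cons.1 hb').2
          cases ht <;> simp [bodyWord] at hb' hl
          case moveLeft q₁ a₁ q₂ hM =>
            obtain ⟨⟨rfl, rfl⟩, -⟩ := hb'
            subst hl
            refine ⟨_, _, _, _, Next.left (u := []) hM, ?_⟩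
            simp [bodyWord, rightWord, map_top_of_isRow_idle hb'' hr]

theorem eq_none_of_isRow_halt {M : TM0.Machine Γ Q} {q : Q} {a : Γ} {v : List Γ} :
    ∀ {u : List Γ} {ts : List (Tile (Vert Γ Q) (Horiz Q))}, ts.map Tile.bottom = bodyWord u q a v →
      IsRow {t | IsStepTile M t} (some halt) ts → M q a = none
  | u, [], hb, _ => by cases u <;> simp [bodyWord] at hb
  | [], t :: ts, hb, ⟨ht, hl, hne, hr⟩ => by
    cases ht <;> simp [bodyWord] at hb hl
    case close q₁ a₁ hM =>
      obtain ⟨⟨rfl, rfl⟩, -⟩ := hb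
      exact hM
  | x :: u, t :: ts, hb, ⟨ht, hl, hne, hr⟩ => by
    have hb' : ts.map Tile.bottom = bodyWord u q a v := (List.cons_eq_cons.1 hb).2
    cases ht <;> simp [bodyWord] at hb hl
    exact eq_none_of_isRow_halt hb' hr

/-- A row above a configuration carries the next configuration on its top, unless the machine has
halted. -/
theorem next_or_halt_of_isRow {M : TM0.Machine Γ Q} {u : List Γ} {q : Q} {a : Γ} {v : List Γ}
    {ts : List (Tile (Vert Γ Q) (Horiz Q))} (hb : ts.map Tile.bottom = word u q a v)
    (h : IsRow {t | IsStepTile M t} none ts) :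
    M q a = none ∨
      ∃ u' q' a' v', Next M u q a v u' q' a' v' ∧ ts.map Tile.top = word u' q' a' v' := by
  cases ts with
  | nil => simp [word] at hb
  | cons t ts =>
    obtain ⟨ht, hl, -, hr⟩ := h
    have hb' : ts.map Tile.bottom = bodyWord u q a v := (List.cons_eq_cons.1 hb).2
    cases ht <;> simp [word] at hb hl
    · obtain ⟨u', q', a', v', hn, ht⟩ := exists_next_of_isRow hb' hr
      exact Or.inr ⟨_, _, _, _, hn, by simp [word, ht]⟩
    · exact Or.inl (eq_none_of_isRow_halt hb' hr)

/-- The labels of the vertical sides count the input symbols that have been placed. -/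
theorem map_top_of_isRow_seed_succ [Inhabited Γ] {a b : Γ} {n : ℕ} :
    ∀ {ts : List (Tile (Vert Γ Q) (Horiz Q))} {k : ℕ}, k ≤ n →
      IsRow {t | IsSeedTile a b n t} (some (seed (k + 1))) ts →
      ∃ j, ts.map Tile.top = rightWord (List.replicate (n - k) b ++ List.replicate j default)
  | [], k, _, h => by simp [IsRow] at h
  | t :: ts, k, hk, ⟨ht, hl, hne, hr⟩ => by
    cases ht <;> simp [inputTile] at hl
    case input i hi =>
      subst hl
      obtain ⟨j, hj⟩ := map_top_of_isRow_seed_succ (k := i + 1) hi hr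
      refine ⟨j, ?_⟩
      rw [show n - i = (n - (i + 1)) + 1 by omega, List.replicate_succ]
      simp [hj, rightWord, inputTile]
    case rightBlank =>
      subst hl
      obtain ⟨j, hj⟩ := map_top_of_isRow_seed_succ hk hr
      refine ⟨j + 1, ?_⟩
      rw [List.replicate_succ]
      simpa [rightWord] using hj
    case rightEdge =>
      subst hl
      cases ts with
      | nil => exact ⟨0, by simp [rightWord]⟩
      | cons t ts =>
        exact absurd rfl (hne (by simp))

theorem map_top_of_isRow_seed_zero [Inhabited Γ] {a b : Γ} {n : ℕ} :
    ∀ {ts : List (Tile (Vert Γ Q) (Horiz Q))}, IsRow {t | IsSeedTile a b n t} (some (seed 0)) ts →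
      ∃ i j, ts.map Tile.top = bodyWord (List.replicate i default) default a
        (List.replicate n b ++ List.replicate j default)
  | [], h => by simp [IsRow] at h
  | t :: ts, ⟨ht, hl, hne, hr⟩ => by
    cases ht <;> simp [inputTile] at hl
    case leftBlank =>
      obtain ⟨i, j, h⟩ := map_top_of_isRow_seed_zero hr
      refine ⟨i + 1, j, ?_⟩
      rw [List.replicate_succ]
      simpa [bodyWord] using h
    case start =>
      obtain ⟨j, h⟩ := map_top_of_isRow_seed_succ (k := 0) n.zero_le hr
      exact ⟨0, j, by simpa [bodyWord] using h⟩

theorem map_top_of_isRow_seed [Inhabited Γ] {a b : Γ} {n : ℕ}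
    {ts : List (Tile (Vert Γ Q) (Horiz Q))}
    (hne : ts ≠ []) (h : IsRow {t | IsSeedTile a b n t} none ts) :
    ∃ i j, ts.map Tile.top = word (List.replicate i default) default a
      (List.replicate n b ++ List.replicate j default) := by
  cases ts with
  | nil => exact absurd rfl hne
  | cons t ts =>
    obtain ⟨ht, hl, -, hr⟩ := h
    cases ht <;> simp [inputTile] at hl
    obtain ⟨i, j, h⟩ := map_top_of_isRow_seed_zero hr
    exact ⟨i, j, by simp [word, h]⟩

theorem cfg_replicate_eq_init [Inhabited Γ] (a b : Γ) (n i j : ℕ) :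
    cfg (List.replicate i default) default a (List.replicate n b ++ List.replicate j default) =
      (TM0.init (a :: List.replicate n b) : TM0.Cfg Γ Q) := by
  unfold cfg TM0.init Tape.mk₁ Tape.mk₂
  congr 2
  · exact Quotient.sound' (Or.inr ⟨i, by simp⟩)
  · exact Quotient.sound' (Or.inr ⟨j, by simp⟩)

/-- Some row of tiles from `T` that starts with the left label `l` has the bottoms `bs` and the tops
`ts`. -/
def RowExists {V H : Type*} (T : Set (Tile V H)) (l : Option H) (bs ts : List (Option V)) : Prop :=
  ∃ r, IsRow T l r ∧ r.map Tile.bottom = bs ∧ r.map Tile.top = ts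

theorem RowExists.cons {V H : Type*} {T : Set (Tile V H)} {bs ts : List (Option V)} {t b l} {r : H}
    (ht : ⟨t, some r, b, l⟩ ∈ T) (h : RowExists T (some r) bs ts) :
    RowExists T l (b :: bs) (t :: ts) := by
  obtain ⟨rs, h1, h2, h3⟩ := h
  exact ⟨_ :: rs, ⟨ht, rfl, fun _ => by simp, h1⟩, by simp [h2], by simp [h3]⟩

theorem RowExists.single {V H : Type*} {T : Set (Tile V H)} {t : Option V} {b : Option V}
    {l : Option H} (ht : ⟨t, none, b, l⟩ ∈ T) : RowExists T l [b] [t] :=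
  ⟨[_], ⟨ht, rfl, fun h => absurd rfl h, rfl⟩, rfl, rfl⟩

section

variable {M : TM0.Machine Γ Q} {T : Set (Tile (Vert Γ Q) (Horiz Q))}

theorem rowExists_idle (hT : ∀ t, IsStepTile M t → t ∈ T) (v : List Γ) :
    RowExists T (some idle) (rightWord v) (rightWord v) := by
  induction v with
  | nil => exact .single (hT _ .rightEdge)
  | cons c v ih => exact .cons (hT _ (.copy c)) ih

theorem rowExists_next (hT : ∀ t, IsStepTile M t → t ∈ T) {u q a v u' q' a' v'}
    (h : Next M u q a v u' q' a' v') : RowExists T none (word u q a v) (word u' q' a' v') := by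
  refine .cons (hT _ .leftEdge) ?_
  have key : ∀ (u₀ : List Γ) {bs ts}, RowExists T (some idle) bs ts → RowExists T (some idle)
      (u₀.map (fun c => some (sym c)) ++ bs) (u₀.map (fun c => some (sym c)) ++ ts) := by
    intro u₀ bs ts h
    induction u₀ with
    | nil => exact h
    | cons c u₀ ih => exact .cons (hT _ (.copy c)) ih
  cases h with
  | write h => exact key _ (.cons (hT _ (.write h)) (rowExists_idle hT _))
  | right h =>
    have := key u (.cons (hT _ (.moveRight h))
      (.cons (hT _ (.fromLeft q' a')) (rowExists_idle hT v')))
    simpa [bodyWord, rightWord] using this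
  | left h =>
    have := key u' (.cons (hT _ (.fromRight q' a'))
      (.cons (hT _ (.moveLeft h)) (rowExists_idle hT v)))
    simpa [bodyWord, rightWord] using this

theorem rowExists_halt (hT : ∀ t, IsStepTile M t → t ∈ T) {q a} (h : M q a = none)
    (u v : List Γ) : ∃ k, RowExists T none (word u q a v) (List.replicate k none) := by
  have h1 : ∃ k, RowExists T (some halt) (rightWord v) (List.replicate k none) := by
    induction v with
    | nil => exact ⟨1, .single (hT _ .rightEdgeHalt)⟩
    | cons c v ih => exact ih.imp' (· + 1) fun k hk => .cons (hT _ (.erase c)) hk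
  have h2 : ∃ k, RowExists T (some halt) (bodyWord u q a v) (List.replicate k none) := by
    induction u with
    | nil => exact h1.imp' (· + 1) fun k hk => .cons (hT _ (.close h)) hk
    | cons c u ih => exact ih.imp' (· + 1) fun k hk => .cons (hT _ (.erase c)) hk
  exact h2.imp' (· + 1) fun k hk => .cons (hT _ .leftEdgeHalt) hk

theorem rowExists_seed [Inhabited Γ] {a b : Γ} {n : ℕ}
    (hT : ∀ t, IsSeedTile a b n t → t ∈ T) (i j : ℕ) :
    ∃ k, RowExists T none (List.replicate (k + 1) none) (word (List.replicate i default) default a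
      (List.replicate n b ++ List.replicate j default)) := by
  have h1 : ∃ k, RowExists T (some (seed (n + 1))) (List.replicate k none)
      (rightWord (List.replicate j default)) := by
    induction j with
    | zero => exact ⟨1, .single (hT _ .rightEdge)⟩
    | succ j ih => exact ih.imp' (· + 1) fun k hk => .cons (hT _ .rightBlank) hk
  have h2 : ∀ m l, m + l = n → ∃ k, RowExists T (some (seed (m + 1))) (List.replicate k none)
      (rightWord (List.replicate l b ++ List.replicate j default)) := by
    intro m l
    induction l generalizing m with
    | zero =>
      rintro rfl
      simpa using h1
    | succ l ih =>
      intro h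
      exact (ih (m + 1) (by omega)).imp' (· + 1) fun k hk =>
        .cons (hT _ (.input m (by omega))) hk
  have h3 : ∃ k, RowExists T (some (seed 0)) (List.replicate k none)
      (bodyWord (List.replicate i default) default a
        (List.replicate n b ++ List.replicate j default)) := by
    induction i with
    | zero => exact (h2 0 n (by omega)).imp' (· + 1) fun k hk => .cons (hT _ .start) hk
    | succ i ih => exact ih.imp' (· + 1) fun k hk => .cons (hT _ .leftBlank) hk
  exact h3.imp fun k hk => .cons (hT _ .leftEdge) hk

/-- A halting computation can be drawn on every tape segment with enough space on both sides. Space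
for one more cell per remaining step is enough, as each step moves the head by at most one cell. -/
theorem exists_isTower [Inhabited Γ] (hT : ∀ t, IsStepTile M t → t ∈ T) {c c' : TM0.Cfg Γ Q}
    (h : StateTransition.Reaches (TM0.step M) c c') (hc' : TM0.step M c' = none) :
    ∃ k, ∀ u q a v, c = cfg u q a v → k ≤ u.length → k ≤ v.length →
      ∃ rs, IsTower T (word u q a v) rs := by
  induction h using Relation.ReflTransGen.head_induction_on with
  | refl =>
    refine ⟨0, fun u q a v hc _ _ => ?_⟩
    subst hc
    have hM : M q a = none := by
      cases hM : M q a with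
      | none => rfl
      | some p => simp [TM0.step, cfg, hM] at hc'
    obtain ⟨k, r, h1, h2, h3⟩ := rowExists_halt hT hM u v
    exact ⟨[r], h1, h2, fun h => absurd rfl h, by simp [IsTower, h3]⟩
  | @head c d hcd _ ih =>
    obtain ⟨k, ih⟩ := ih
    refine ⟨k + 1, fun u q a v hc hu hv => ?_⟩
    subst hc
    obtain ⟨u', q', a', v', hn, hd, hu', hv'⟩ := exists_next
      (List.ne_nil_of_length_pos (by omega)) (List.ne_nil_of_length_pos (by omega)) hcd
    obtain ⟨rs, hrs⟩ := ih _ _ _ _ hd (by omega) (by omega)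
    obtain ⟨r, h1, h2, h3⟩ := rowExists_next hT hn
    exact ⟨r :: rs, h1, h2, fun _ => h3 ▸ none_notMem_word _ _ _ _, h3.symm ▸ hrs⟩

end

theorem IsRow.mono {V H : Type*} {T T' : Set (Tile V H)} : ∀ {ts : List (Tile V H)} {l : Option H},
    IsRow T l ts → (∀ t ∈ ts, t ∈ T → t ∈ T') → IsRow T' l ts
  | [], _, h, _ => h
  | t :: ts, _, ⟨h1, h2, h3, h4⟩, h =>
    ⟨h t (by simp) h1, h2, h3, h4.mono fun t' ht' => h t' (by simp [ht'])⟩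

theorem dom_eval_iff [Inhabited Γ] {M : TM0.Machine Γ Q} {l : List Γ} :
    (TM0.eval M l).Dom ↔
      ∃ c, StateTransition.Reaches (TM0.step M) (TM0.init l) c ∧ TM0.step M c = none := by
  simp only [← StateTransition.mem_eval]
  change (StateTransition.eval (TM0.step M) (TM0.init l)).Dom ↔ _
  exact Part.dom_iff_mem

/-- The puzzle made of the tiles of a machine and an input is solvable exactly if the machine halts
on this input. -/
theorem solvable_iff_dom [Inhabited Γ] {M : TM0.Machine Γ Q} {a b : Γ} {n : ℕ}
    {e : Vert Γ Q ⊕ Horiz Q → ℕ} (he : e.Injective) {L : List (Tile (Vert Γ Q) (Horiz Q))}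
    (hL : ∀ t, t ∈ L ↔ IsStepTile M t ∨ IsSeedTile a b n t) :
    Solvable (L.map (Tile.toPiece e)) ↔ (TM0.eval M (a :: List.replicate n b)).Dom := by
  rw [dom_eval_iff]
  constructor
  · intro hS
    by_contra hdom
    -- every row carries a configuration that the machine reaches
    refine not_solvable_of_invariant he (fun h => ∃ k, h = seed k) ?_
      (fun w => ∃ u q c v, w = word u q c v ∧ StateTransition.Reaches (TM0.step M)
        (TM0.init (a :: List.replicate n b)) (cfg u q c v)) ?_ ?_ ?_ hS
    · intro t ht h hh
      rcases (hL t).1 ht with ht | ht <;> rcases hh with hh | hh <;> cases ht <;> cases hh <;>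
        simp [inputTile]
    · intro ts hne hts hbot
      obtain ⟨i, j, h⟩ := map_top_of_isRow_seed (a := a) (b := b) (n := n) hne <| hts.mono <| by
        intro t ht htL
        refine ((hL t).1 htL).resolve_left fun h => ?_
        have := hbot t ht
        cases h <;> simp at this
      exact ⟨_, _, _, _, h, by rw [cfg_replicate_eq_init]; exact .refl⟩
    · rintro ts hts ⟨u, q, c, v, hb, hr⟩
      have := next_or_halt_of_isRow (M := M) hb <| hts.mono <| by
        intro t ht htL
        refine ((hL t).1 htL).resolve_right fun h => ?_
        have h0 : t.bottom = none := by cases h <;> rfl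
        exact none_notMem_word u q c v (hb ▸ List.mem_map.2 ⟨t, ht, h0⟩)
      rcases this with hM | ⟨u', q', c', v', hn, ht⟩
      · exact absurd ⟨_, hr, by simp [TM0.step, cfg, hM]⟩ hdom
      · exact ⟨_, _, _, _, ht, hr.tail hn.step_eq⟩
    · rintro _ ⟨u, q, c, v, rfl, -⟩
      exact none_notMem_word u q c v
  · rintro ⟨c, hr, hc⟩
    obtain ⟨k, hk⟩ := exists_isTower (T := {t | t ∈ L}) (fun t ht => (hL t).2 (Or.inl ht)) hr hc
    obtain ⟨rs, hrs⟩ := hk _ _ _ _ (cfg_replicate_eq_init a b n k k).symm (by simp) (by simp)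
    obtain ⟨m, r, h1, h2, h3⟩ := rowExists_seed (T := {t | t ∈ L}) (a := a) (b := b) (n := n)
      (fun t ht => (hL t).2 (Or.inr ht)) k k
    exact solvable_of_isTower he m.succ_pos (List.cons_ne_nil r rs)
      ⟨h1, h2, fun _ => h3 ▸ none_notMem_word _ _ _ _, h3.symm ▸ hrs⟩

end

end Jigsaw

/-! ### The reduction is computable -/

namespace Jigsaw

open Turing Vert Horiz

variable {Γ Q : Type}

instance [Finite Γ] [Finite Q] : Finite (Vert Γ Q) := by
  refine Finite.of_injective (β := Option (Γ ⊕ Q × Γ))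
    (fun | edge => none | sym c => some (.inl c) | head q c => some (.inr (q, c))) ?_
  rintro (_ | _ | _) (_ | _ | _) <;> simp

instance [Finite Q] : Countable (Horiz Q) := by
  refine Function.Injective.countable (β := Bool ⊕ (Q ⊕ Q) ⊕ ℕ) (f := fun
    | idle => .inl true | halt => .inl false | toRight q => .inr (.inl (.inl q))
    | toLeft q => .inr (.inl (.inr q)) | seed k => .inr (.inr k)) ?_
  rintro (_ | _ | _ | _ | _) (_ | _ | _ | _ | _) <;> simp

/-- There is a numbering of the labels that is computable on the vertical sides within the initial
row. All other labels belong to the fixed machine, so their numbers need not be computable. -/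
theorem exists_numbering (Γ Q : Type) [Finite Γ] [Finite Q] :
    ∃ e : Vert Γ Q ⊕ Horiz Q → ℕ, e.Injective ∧ ∀ k, e (.inr (seed k)) = 2 * k + 1 := by
  obtain ⟨i, hi⟩ := Countable.exists_injective_nat (Vert Γ Q ⊕ Horiz Q)
  refine ⟨fun | .inr (seed k) => 2 * k + 1 | x => 2 * i x, ?_, fun k => rfl⟩
  rintro (_ | _ | _ | _ | _ | _) (_ | _ | _ | _ | _ | _) h <;> dsimp only at h <;>
    first
      | exact hi (by omega)
      | omega
      | exact congrArg (fun k => Sum.inr (seed k)) (by omega)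

theorem finite_setOf_isStepTile [Finite Γ] [Finite Q] [Inhabited Q] (M : TM0.Machine Γ Q) :
    {t | IsStepTile M t}.Finite := by
  let h : Bool ⊕ Q ⊕ Q → Horiz Q :=
    Sum.elim (fun b => bif b then idle else halt) (Sum.elim toRight toLeft)
  let F : Option (Vert Γ Q) × Option (Bool ⊕ Q ⊕ Q) × Option (Vert Γ Q) × Option (Bool ⊕ Q ⊕ Q) →
      Tile (Vert Γ Q) (Horiz Q) := fun x => ⟨x.1, x.2.1.map h, x.2.2.1, x.2.2.2.map h⟩
  refine (Set.finite_range F).subset ?_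
  rintro t (_ | _ | _ | _ | _ | _ | _ | @⟨q, a, q', hM⟩ | @⟨q, a, q', hM⟩ | ⟨q, c⟩ | ⟨q, c⟩ | _)
  · exact ⟨(_, some (.inl true), _, none), rfl⟩
  · exact ⟨(_, some (.inl false), _, none), rfl⟩
  · exact ⟨(_, none, _, some (.inl true)), rfl⟩
  · exact ⟨(_, none, _, some (.inl false)), rfl⟩
  · exact ⟨(_, some (.inl true), _, some (.inl true)), rfl⟩
  · exact ⟨(_, some (.inl false), _, some (.inl false)), rfl⟩
  · exact ⟨(_, some (.inl true), _, some (.inl true)), rfl⟩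
  · exact ⟨(_, some (.inr (.inl q')), _, some (.inl true)), rfl⟩
  · exact ⟨(_, some (.inl true), _, some (.inr (.inr q'))), rfl⟩
  · exact ⟨(_, some (.inl true), _, some (.inr (.inl q))), rfl⟩
  · exact ⟨(_, some (.inr (.inr q)), _, some (.inl true)), rfl⟩
  · exact ⟨(_, some (.inl false), _, some (.inl false)), rfl⟩

/-- The list of the tiles of the initial row. -/
def seedTiles [Inhabited Γ] [Inhabited Q] (a b : Γ) (n : ℕ) : List (Tile (Vert Γ Q) (Horiz Q)) :=
  [⟨some edge, some (seed 0), none, none⟩,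
    ⟨some (sym default), some (seed 0), none, some (seed 0)⟩,
    ⟨some (head default a), some (seed 1), none, some (seed 0)⟩,
    ⟨some (sym default), some (seed (n + 1)), none, some (seed (n + 1))⟩,
    ⟨some edge, none, none, some (seed (n + 1))⟩] ++ (List.range n).map (inputTile b)

theorem mem_seedTiles [Inhabited Γ] [Inhabited Q] {a b : Γ} {n : ℕ}
    {t : Tile (Vert Γ Q) (Horiz Q)} : t ∈ seedTiles a b n ↔ IsSeedTile a b n t := by
  simp only [seedTiles, List.cons_append, List.nil_append, List.mem_cons, List.mem_map,
    List.mem_range]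
  constructor
  · rintro (rfl | rfl | rfl | rfl | rfl | ⟨i, hi, rfl⟩)
    exacts [.leftEdge, .leftBlank, .start, .rightBlank, .rightEdge, .input i hi]
  · intro h
    cases h with
    | input i hi => exact Or.inr (Or.inr (Or.inr (Or.inr (Or.inr ⟨i, hi, rfl⟩))))
    | _ => simp

theorem primrec_intCast : Primrec fun n : ℕ => (n : ℤ) := by
  refine Primrec.encode_iff.1 ((Primrec.nat_mul.comp (Primrec.const 2) Primrec.id).of_eq ?_)
  exact fun n => rfl

theorem primrec_neg_intCast : Primrec fun n : ℕ => -(n : ℤ) := by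
  refine Primrec.encode_iff.1 ((Primrec.nat_sub.comp
    (Primrec.nat_mul.comp (Primrec.const 2) Primrec.id) (Primrec.const 1)).of_eq ?_)
  rintro (_ | n)
  · rfl
  · change 2 * (n + 1) - 1 = 2 * n + 1
    omega

theorem primrec_map_toPiece_seedTiles [Inhabited Γ] [Inhabited Q]
    {e : Vert Γ Q ⊕ Horiz Q → ℕ} (he : ∀ k, e (.inr (seed k)) = 2 * k + 1) (a b : Γ) :
    Primrec fun n => (seedTiles a b n).map (Tile.toPiece e) := by
  have hcolor : ∀ k, Tile.labelColor e (some (.inr (seed k))) = ((2 * (k + 1) : ℕ) : ℤ) := by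
    intro k
    simp only [Tile.labelColor, he]
    push_cast
    ring
  have hnat : ∀ c, Primrec fun k : ℕ => 2 * (k + c) := fun c =>
    Primrec.nat_mul.comp (Primrec.const 2) (Primrec.nat_add.comp Primrec.id (Primrec.const c))
  have hpos : ∀ c, Primrec fun k : ℕ => Tile.labelColor e (some (.inr (seed (k + c)))) := fun c =>
    (primrec_intCast.comp (hnat (c + 1))).of_eq fun k => by rw [hcolor, add_assoc]
  have hneg : ∀ c, Primrec fun k : ℕ => -Tile.labelColor e (some (.inr (seed (k + c)))) := fun c =>
    (primrec_neg_intCast.comp (hnat (c + 1))).of_eq fun k => by rw [hcolor, add_assoc]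
  have hinput : Primrec fun i => (inputTile b i : Tile (Vert Γ Q) (Horiz Q)).toPiece e :=
    (Primrec.const _).pair ((hpos 2).pair ((Primrec.const _).pair (hneg 1)))
  have hblank : Primrec fun n => Tile.toPiece e
      (⟨some (sym default), some (seed (n + 1)), none, some (seed (n + 1))⟩ :
        Tile (Vert Γ Q) (Horiz Q)) :=
    (Primrec.const _).pair ((hpos 1).pair ((Primrec.const _).pair (hneg 1)))
  have hedge : Primrec fun n => Tile.toPiece e
      (⟨some edge, none, none, some (seed (n + 1))⟩ : Tile (Vert Γ Q) (Horiz Q)) :=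
    (Primrec.const _).pair ((Primrec.const _).pair ((Primrec.const _).pair (hneg 1)))
  simp only [seedTiles, List.cons_append, List.nil_append, List.map_cons, List.map_map]
  exact Primrec.list_cons.comp (Primrec.const _) (Primrec.list_cons.comp (Primrec.const _)
    (Primrec.list_cons.comp (Primrec.const _) (Primrec.list_cons.comp hblank
      (Primrec.list_cons.comp hedge
        (Primrec.list_map Primrec.list_range (hinput.comp₂ Primrec₂.right))))))

end Jigsaw

open Jigsaw Turing in
theorem mainTheorem2 : ¬ ComputablePred (fun S : List Jigsaw.Piece => Jigsaw.Solvable S) := by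
  intro hC
  obtain ⟨Γ, Q, _, _, _, _, M, a, b, hM⟩ := exists_machine_not_computablePred
  obtain ⟨e, he, hseed⟩ := exists_numbering Γ Q
  -- only the tiles of the initial row depend on the input
  let steps := (finite_setOf_isStepTile M).toFinset.toList
  have hL : ∀ n t, t ∈ steps ++ seedTiles a b n ↔ IsStepTile M t ∨ IsSeedTile a b n t := by
    intro n t
    simp [steps, mem_seedTiles]
  refine hM (ComputablePred.computable_of_manyOneReducible
    (q := fun S : List Jigsaw.Piece => Jigsaw.Solvable S)
    ⟨fun n => (steps ++ seedTiles a b n).map (Tile.toPiece e), ?_,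
      fun n => (solvable_iff_dom he (hL n)).symm⟩ hC)
  refine Primrec.to_comp ((Primrec.list_append.comp (Primrec.const (steps.map (Tile.toPiece e)))
    (primrec_map_toPiece_seedTiles hseed a b)).of_eq fun n => ?_)
  rw [List.map_append]
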